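/- Let $(V,\rho)$ be a finite metric space. For distinct $a,b\in V$, the line $\overline{ab}$ generated by $a$ and $b$ is the set consisting of $a$, $b$ and all points $c\in V\setminus\{a,b\}$ for which one of $\rho(a,b)=\rho(a,c)+\rho(c,b)$, $\rho(a,c)=\rho(a,b)+\rho(b,c)$, $\rho(b,c)=\rho(b,a)+\rho(a,c)$ holds. The lines of $(V,\rho)$ are the sets $\overline{ab}$ with $a\neq b$, distinct lines being distinct sets; a line is universal if it equals $V$. The metric $\rho$ is a graph metric if there is a connected graph with vertex set $V$ in which, for all $u,v\in V$, $\rho(u,v)$ is the number of edges of a shortest path from $u$ to $v$. Theorem. There is a function $\varepsilon:\mathbb{N}\to\mathbb{R}$ with $\varepsilon(n)\to 0$ as $n\to\infty$ such that every $n$-point metric space whose metric is a graph metric either has a universal line or has at least $\left(\tfrac12-\varepsilon(n)\right)n^{4/7}$ distinct lines. -/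

import Mathlib

open Filter Topology

namespace MetricLines

variable {V : Type*} [MetricSpace V]

/-- `[abc]`: the points `a`, `b`, `c` are distinct and `b` lies between `a` and `c`. -/
def Between (a b c : V) : Prop :=
  a ≠ b ∧ b ≠ c ∧ a ≠ c ∧ dist a c = dist a b + dist b c

/-- The line generated by `a` and `b` (meant for `a ≠ b`): it consists of `a`, `b` and all points
`c` such that one of the three points `a`, `b`, `c` lies between the two others. -/
def line (a b : V) : Set V :=
  {a, b} ∪ {c | Between a c b ∨ Between a b c ∨ Between b a c}

variable (V)

/-- The set of all lines of the metric space `V`. Two pairs of points that generate the same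
set of points contribute one line. -/
def lines : Set (Set V) :=
  {L | ∃ a b : V, a ≠ b ∧ L = line a b}

/-- Some line contains all points of `V`. -/
def HasUniversalLine : Prop :=
  ∃ L ∈ lines V, ∀ x : V, x ∈ L

/-- The metric of `V` is the shortest-path metric of some connected graph with vertex set `V`. -/
def IsGraphMetric : Prop :=
  ∃ G : SimpleGraph V, G.Connected ∧ ∀ u v : V, dist u v = (G.dist u v : ℝ)

end MetricLines

/-! ### Lines and geodesics of the shortest-path metric. -/

namespace GraphLines

variable {V : Type*} {G : SimpleGraph V}

/-! Double counting of the ordered pairs of distinct vertices by the line they generate. Let there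
be n vertices and m lines, none universal, and put P = ⌊√(2m)⌋ + 1. A set without collinear triples
has at most P points (`card_le_sqrt_of_no_col`); this bounds every family below whose members turn
out to be pairwise far apart.

Each line is generated by few pairs. Adjacent pairs number O(P m²) (`card_adjacent_pairs_le`): a
vertex w off the line is equidistant from both ends of every such edge, which controls edges whose
ends lie on a common line through w. Pairs at distance at least 2 number at most 3n + O(P D²), where
D bounds the diameter (`card_distant_pairs_le`): apart from about 3n exceptions they point away from
or towards one fixed vertex, and are classified by two distances. Finally D ≤ 2m
(`dist_le_two_mul_card`), since a long geodesic already yields many lines.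

Summing over the lines gives n² ≤ O(nm + m^(7/2)), so m is of order at least n^(4/7);
`half_mul_rpow_le` checks the constant. -/

/-- One of the three vertices lies on a shortest path between the two others;
coincidences are allowed. -/
def Col (G : SimpleGraph V) (a b c : V) : Prop :=
  G.dist a b = G.dist a c + G.dist c b ∨ G.dist a c = G.dist a b + G.dist b c ∨
    G.dist c b = G.dist c a + G.dist a b

/-- The line generated by two vertices in the shortest-path metric. -/
def graphLine (G : SimpleGraph V) (a b : V) : Set V := {c | Col G a b c}

theorem mem_graphLine {a b c : V} : c ∈ graphLine G a b ↔ Col G a b c := Iff.rfl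

theorem left_mem_graphLine (a b : V) : a ∈ graphLine G a b := by
  simp [mem_graphLine, Col]

theorem right_mem_graphLine (a b : V) : b ∈ graphLine G a b := by
  simp [mem_graphLine, Col]

theorem graphLine_comm (a b : V) : graphLine G a b = graphLine G b a := by
  ext c
  simp only [mem_graphLine, Col]
  have h1 := G.dist_comm (u := a) (v := b)
  have h2 := G.dist_comm (u := a) (v := c)
  have h3 := G.dist_comm (u := c) (v := b)
  omega

theorem dist_ne_zero (hG : G.Connected) {a b : V} (h : a ≠ b) : G.dist a b ≠ 0 :=
  fun h0 => h (hG.dist_eq_zero_iff.1 h0)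

theorem exists_dist_succ (hG : G.Connected) {a b : V} (h : a ≠ b) :
    ∃ c, G.dist a c = 1 ∧ G.dist a b = G.dist c b + 1 := by
  obtain ⟨p, hp⟩ := hG.exists_walk_length_eq_dist a b
  cases p with
  | nil => exact absurd rfl h
  | @cons _ c _ hac q =>
    refine ⟨c, SimpleGraph.dist_eq_one_iff_adj.2 hac, ?_⟩
    have h1 : G.dist c b ≤ q.length := SimpleGraph.dist_le q
    have h2 := hG.dist_triangle (u := a) (v := c) (w := b)
    have h3 : G.dist a c = 1 := SimpleGraph.dist_eq_one_iff_adj.2 hac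
    simp only [SimpleGraph.Walk.length_cons] at hp
    omega

theorem exists_geodesic (hG : G.Connected) (n : ℕ) : ∀ u v : V, G.dist u v = n →
    ∃ x : ℕ → V, x 0 = u ∧ x n = v ∧
      ∀ i j, i ≤ j → j ≤ n → G.dist (x i) (x j) + i = j := by
  induction n with
  | zero =>
    intro u v h
    refine ⟨fun _ => u, rfl, hG.dist_eq_zero_iff.1 h, ?_⟩
    intro i j hij hj
    have hi : i = 0 := by omega
    have hj : j = 0 := by omega
    simp [hi, hj]
  | succ n ih =>
    intro u v h
    have huv : u ≠ v := by
      rintro rfl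
      simp at h
    obtain ⟨c, huc, hc⟩ := exists_dist_succ hG huv
    obtain ⟨x, hx0, hxn, hx⟩ := ih c v (by omega)
    refine ⟨fun i => Nat.casesOn i u x, rfl, hxn, ?_⟩
    intro i j hij hj
    rcases i with _ | i <;> rcases j with _ | j
    · simp
    · change G.dist u (x j) + 0 = j + 1
      have h1 := hx 0 j (by omega) (by omega)
      have h2 := hx j n (by omega) le_rfl
      rw [hx0] at h1
      rw [hxn] at h2
      have h3 := hG.dist_triangle (u := u) (v := c) (w := x j)
      have h4 := hG.dist_triangle (u := u) (v := x j) (w := v)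
      omega
    · omega
    · change G.dist (x i) (x j) + (i + 1) = j + 1
      have := hx i j (by omega) (by omega)
      omega

/-! ### Sets without collinear triples, and the diameter bound. -/

section Counting

variable {𝓛 : Finset (Set V)}

/-- A line through two points of `A` meets `A` only in them, so it arises from at most two ordered
pairs, and |A|(|A| − 1) ≤ 2|𝓛|. -/
theorem card_le_sqrt_of_no_col (h𝓛 : ∀ a b, a ≠ b → graphLine G a b ∈ 𝓛) (A : Finset V)
    (hA : ∀ a ∈ A, ∀ b ∈ A, ∀ c ∈ A, a ≠ b → a ≠ c → b ≠ c → ¬ Col G a b c) :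
    A.card ≤ Nat.sqrt (2 * 𝓛.card) + 1 := by
  classical
  have key : A.offDiag.card ≤ 2 * 𝓛.card := by
    refine Finset.card_le_mul_card_image_of_maps_to (f := fun p : V × V => graphLine G p.1 p.2)
      (fun p hp => h𝓛 _ _ (Finset.mem_offDiag.1 hp).2.2) 2 ?_
    intro L _
    rcases Finset.eq_empty_or_nonempty
      {p ∈ A.offDiag | graphLine G p.1 p.2 = L} with h0 | ⟨⟨a, b⟩, hab⟩
    · simp [h0]
    · simp only [Finset.mem_filter, Finset.mem_offDiag] at hab
      obtain ⟨⟨ha, hb, hne⟩, hL⟩ := hab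
      have hmem : ∀ c ∈ A, c ∈ L → c = a ∨ c = b := by
        intro c hc hcL
        by_contra hcon
        push Not at hcon
        rw [← hL] at hcL
        exact hA a ha b hb c hc hne hcon.1.symm hcon.2.symm hcL
      refine (Finset.card_le_card (t := {(a, b), (b, a)}) ?_).trans Finset.card_le_two
      rintro ⟨c, e⟩ hce
      simp only [Finset.mem_filter, Finset.mem_offDiag] at hce
      obtain ⟨⟨hc, he, hce'⟩, hL'⟩ := hce
      have h1 := hmem c hc (hL' ▸ left_mem_graphLine c e)
      have h2 := hmem e he (hL' ▸ right_mem_graphLine c e)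
      simp only [Finset.mem_insert, Finset.mem_singleton, Prod.mk.injEq]
      rcases h1 with rfl | rfl <;> rcases h2 with rfl | rfl <;> simp_all
  rw [Finset.offDiag_card] at key
  have h2 : A.card - 1 ≤ Nat.sqrt (2 * 𝓛.card) := by
    rw [Nat.le_sqrt]
    refine le_trans ?_ key
    rcases Nat.eq_zero_or_pos A.card with h | h
    · simp [h]
    · obtain ⟨k, hk⟩ : ∃ k, A.card = k + 1 := ⟨A.card - 1, by omega⟩
      rw [hk]
      have : (k + 1) * (k + 1) = k * k + k + (k + 1) := by ring
      have h3 : k + 1 - 1 = k := rfl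
      rw [h3]
      omega
  omega

theorem dist_eq_of_not_mem_graphLine (hG : G.Connected) {a b w : V} (hab : G.dist a b = 1)
    (hw : w ∉ graphLine G a b) : G.dist w a = G.dist w b := by
  simp only [mem_graphLine, Col] at hw
  have h1 := hG.dist_triangle (u := w) (v := a) (w := b)
  have h2 := hG.dist_triangle (u := w) (v := b) (w := a)
  have h3 := G.dist_comm (u := a) (v := b)
  have h4 := G.dist_comm (u := a) (v := w)
  have h5 := G.dist_comm (u := b) (v := w)
  omega

theorem dist_ne_of_mem_graphLine {a b w : V} (hab : G.dist a b = 1)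
    (hw : w ∈ graphLine G a b) : G.dist w a ≠ G.dist w b := by
  simp only [mem_graphLine, Col] at hw
  have h3 := G.dist_comm (u := a) (v := b)
  have h4 := G.dist_comm (u := a) (v := w)
  have h5 := G.dist_comm (u := b) (v := w)
  omega

/-- For each edge of a geodesic take `w i` off its line. If the line of `w i`, `x i` met the
geodesic later and the line of `w i`, `x (i + 1)` met it earlier, the detour through `w i` would be
shorter than the geodesic. So one of these never happens, and the indices of either kind give
pairwise distinct lines. -/
theorem dist_le_two_mul_card (hG : G.Connected) (h𝓛 : ∀ a b, a ≠ b → graphLine G a b ∈ 𝓛)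
    (hU : ∀ a b, a ≠ b → ∃ w, w ∉ graphLine G a b) (u v : V) :
    G.dist u v ≤ 2 * 𝓛.card := by
  classical
  obtain ⟨x, -, -, hx⟩ := exists_geodesic hG _ u v rfl
  set n := G.dist u v
  have hstep : ∀ i, i < n → G.dist (x i) (x (i + 1)) = 1 := by
    intro i hi
    have := hx i (i + 1) (by omega) (by omega)
    omega
  have hw : ∀ i, ∃ w, i < n → w ∉ graphLine G (x i) (x (i + 1)) := by
    intro i
    by_cases hi : i < n
    · obtain ⟨w, hw⟩ := hU (x i) (x (i + 1)) (fun h => by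
        have := hstep i hi
        rw [h] at this
        simp at this)
      exact ⟨w, fun _ => hw⟩
    · exact ⟨u, fun h => absurd h hi⟩
  choose w hw using hw
  have hflat : ∀ i, i < n → G.dist (w i) (x i) = G.dist (w i) (x (i + 1)) := fun i hi =>
    dist_eq_of_not_mem_graphLine hG (hstep i hi) (hw i hi)
  have hne : ∀ i, i < n → w i ≠ x i := by
    intro i hi h
    exact hw i hi (h ▸ left_mem_graphLine _ _)
  have hne' : ∀ i, i < n → w i ≠ x (i + 1) := by
    intro i hi h
    exact hw i hi (h ▸ right_mem_graphLine _ _)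
  have hright : ∀ i t, i < n → i < t → t ≤ n → x t ∈ graphLine G (w i) (x i) →
      G.dist (w i) (x i) + G.dist (w i) (x t) + i = t := by
    intro i t hi hit ht hmem
    simp only [mem_graphLine, Col] at hmem
    have h1 := hflat i hi
    have h2 := hx i t (by omega) ht
    have h3 := hx (i + 1) t (by omega) ht
    have h4 := hG.dist_triangle (u := w i) (v := x (i + 1)) (w := x t)
    have h5 := hG.dist_triangle (u := w i) (v := x t) (w := x (i + 1))
    have h6 := G.dist_comm (u := x t) (v := x i)
    have h7 := G.dist_comm (u := x t) (v := x (i + 1))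
    have h8 := G.dist_comm (u := x t) (v := w i)
    omega
  have hleft : ∀ i q, i < n → q ≤ i → x q ∈ graphLine G (w i) (x (i + 1)) →
      G.dist (w i) (x i) + G.dist (w i) (x q) + q = i + 1 := by
    intro i q hi hq hmem
    simp only [mem_graphLine, Col] at hmem
    have h1 := hflat i hi
    have h2 := hx q i (by omega) (by omega)
    have h3 := hx q (i + 1) (by omega) (by omega)
    have h4 := hG.dist_triangle (u := w i) (v := x i) (w := x q)
    have h5 := hG.dist_triangle (u := w i) (v := x q) (w := x i)
    have h6 := G.dist_comm (u := x q) (v := x i)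
    have h7 := G.dist_comm (u := x q) (v := x (i + 1))
    have h8 := G.dist_comm (u := x q) (v := w i)
    omega
  set R : Finset ℕ := {i ∈ Finset.range n | ∀ t, i < t → t ≤ n → x t ∉ graphLine G (w i) (x i)}
  set Q : Finset ℕ := {i ∈ Finset.range n | ∀ q, q ≤ i → x q ∉ graphLine G (w i) (x (i + 1))}
  have hcover : Finset.range n ⊆ R ∪ Q := by
    intro i hi
    rw [Finset.mem_union]
    by_contra hcon
    push Not at hcon
    obtain ⟨hR, hQ⟩ := hcon
    simp only [R, Q, Finset.mem_filter, hi, true_and] at hR hQ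
    push Not at hR hQ
    obtain ⟨t, hit, ht, hmt⟩ := hR
    obtain ⟨q, hq, hmq⟩ := hQ
    have hi' := Finset.mem_range.1 hi
    have h1 := hright i t hi' hit ht hmt
    have h2 := hleft i q hi' hq hmq
    have h3 := hx q t (by omega) ht
    have h4 := hG.dist_triangle (u := x q) (v := w i) (w := x t)
    have h5 := G.dist_comm (u := x q) (v := w i)
    have h6 := dist_ne_zero hG (hne i hi')
    omega
  have hRc : R.card ≤ 𝓛.card := by
    refine Finset.card_le_card_of_injOn (fun i => graphLine G (w i) (x i)) ?_ ?_
    · intro i hi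
      simp only [R, Finset.coe_filter, Set.mem_ofPred_eq, Finset.mem_range] at hi
      exact h𝓛 _ _ (hne i hi.1)
    -- If i < j gave the same line, it would contain the later vertex `x j`.
    · have aux : ∀ i ∈ R, ∀ j ∈ R, graphLine G (w i) (x i) = graphLine G (w j) (x j) →
          ¬ i < j := by
        intro i hi j hj h hij
        simp only [R, Finset.mem_filter, Finset.mem_range] at hi hj
        exact hi.2 j hij hj.1.le (h ▸ right_mem_graphLine _ _)
      intro i hi j hj h
      have h1 := aux i hi j hj h
      have h2 := aux j hj i hi h.symm
      omega
  have hQc : Q.card ≤ 𝓛.card := by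
    refine Finset.card_le_card_of_injOn (fun i => graphLine G (w i) (x (i + 1))) ?_ ?_
    · intro i hi
      simp only [Q, Finset.coe_filter, Set.mem_ofPred_eq, Finset.mem_range] at hi
      exact h𝓛 _ _ (hne' i hi.1)
    · have aux : ∀ i ∈ Q, ∀ j ∈ Q,
          graphLine G (w i) (x (i + 1)) = graphLine G (w j) (x (j + 1)) → ¬ i < j := by
        intro i hi j hj h hij
        simp only [Q, Finset.mem_filter, Finset.mem_range] at hi hj
        exact hj.2 (i + 1) hij (h ▸ right_mem_graphLine _ _)
      intro i hi j hj h
      have h1 := aux i hi j hj h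
      have h2 := aux j hj i hi h.symm
      omega
  have h1 := Finset.card_le_card hcover
  have h2 := Finset.card_union_le R Q
  rw [Finset.card_range] at h1
  omega

end Counting

/-! ### Adjacent pairs generating a given line. -/

section AdjacentPairs

variable {𝓛 : Finset (Set V)}

/-- If two vertices generate the same line with `w`, then their distance is the difference or the
sum of their distances to `w`. -/
theorem dist_eq_of_graphLine_eq {w x z : V} (h : graphLine G w x = graphLine G w z) :
    G.dist x z + G.dist w x = G.dist w z ∨ G.dist x z + G.dist w z = G.dist w x ∨
      G.dist x z = G.dist w x + G.dist w z := by
  have hz : z ∈ graphLine G w x := h ▸ right_mem_graphLine w z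
  simp only [mem_graphLine, Col] at hz
  have h1 := G.dist_comm (u := x) (v := z)
  have h2 := G.dist_comm (u := w) (v := z)
  omega

/-- Let `x < z` in the order of a line through `w`, and let `z y` be an edge whose line contains
all vertices involved but not `w`. No vertex `t ≠ z` of the line through `w` that is at least as far
from `w` as `z` lies on the line generated by `x` and `y`. -/
theorem not_mem_graphLine_of_lt (hG : G.Connected) {w x z y t : V} (hzy : G.dist z y = 1)
    (hw : w ∉ graphLine G z y) (hx : x ∈ graphLine G z y) (ht : t ∈ graphLine G z y)
    (hxz : G.dist x z + G.dist w x = G.dist w z) (hne : x ≠ z) (htz : t ≠ z)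
    (hrt : G.dist w z ≤ G.dist w t) (hxt : graphLine G w x = graphLine G w t)
    (hzt : graphLine G w z = graphLine G w t) : t ∉ graphLine G x y := by
  intro hmem
  have hflat := dist_eq_of_not_mem_graphLine hG hzy hw
  have hxd := dist_ne_of_mem_graphLine hzy hx
  have htd := dist_ne_of_mem_graphLine hzy ht
  have h1 := dist_eq_of_graphLine_eq hxt
  have h2 := dist_eq_of_graphLine_eq hzt
  have hwx : G.dist w x ≠ 0 := dist_ne_zero hG (fun h => hw (h ▸ hx))
  have h3 := dist_ne_zero hG hne
  have h4 := dist_ne_zero hG htz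
  simp only [mem_graphLine, Col] at hmem
  have c1 := G.dist_comm (u := z) (v := t)
  have c2 := G.dist_comm (u := x) (v := t)
  have c3 := G.dist_comm (u := y) (v := z)
  have t1 := hG.dist_triangle (u := x) (v := z) (w := y)
  have t2 := hG.dist_triangle (u := x) (v := y) (w := z)
  have t3 := hG.dist_triangle (u := w) (v := x) (w := y)
  have t4 := hG.dist_triangle (u := t) (v := z) (w := y)
  have t5 := hG.dist_triangle (u := t) (v := y) (w := z)
  have t6 := hG.dist_triangle (u := w) (v := y) (w := t)
  have t7 := hG.dist_triangle (u := y) (v := w) (w := t)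
  have t8 := hG.dist_triangle (u := t) (v := x) (w := z)
  have t9 := hG.dist_triangle (u := x) (v := z) (w := t)
  have c4 := G.dist_comm (u := y) (v := t)
  have c5 := G.dist_comm (u := y) (v := w)
  -- Otherwise `y` would be closer to `x`, hence to `w`, than `z` is.
  have hxy : G.dist x y = G.dist x z + 1 := by omega
  rcases h2 with h2 | h2 | h2
  -- Here `z` lies between `x` and `t`, so the detour through `y` is too long by exactly 2.
  · have hty : G.dist t y = G.dist t z + 1 := by omega
    omega
  · omega
  -- Here `w` lies between `z` and `t`, so `t` is at most as far from `y` as from `z`.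
  · have hty : G.dist t y + 1 = G.dist t z := by omega
    omega

/-- Order `S` by x < z when `x` lies between `w` and `z`. Distances between minimal elements are
sums of distances to `w`, so no three of these are collinear. A non-minimal z gets the line of some
smaller x and the neighbour y of z; `not_mem_graphLine_of_lt` makes these lines distinct. -/
theorem card_graphLine_fiber_le (hG : G.Connected) (h𝓛 : ∀ a b, a ≠ b → graphLine G a b ∈ 𝓛)
    {L Λ : Set V} {w : V} (hw : w ∉ L) (S : Finset V)
    (hS : ∀ x ∈ S, graphLine G w x = Λ ∧ ∃ y, G.dist x y = 1 ∧ graphLine G x y = L) :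
    S.card ≤ 𝓛.card + (Nat.sqrt (2 * 𝓛.card) + 1) := by
  classical
  have hSL : ∀ x ∈ S, x ∈ L := by
    intro x hx
    obtain ⟨-, y, -, rfl⟩ := hS x hx
    exact left_mem_graphLine _ _
  have hy : ∀ x, ∃ y, x ∈ S → G.dist x y = 1 ∧ graphLine G x y = L := by
    intro x
    by_cases hx : x ∈ S
    · obtain ⟨-, y, h⟩ := hS x hx
      exact ⟨y, fun _ => h⟩
    · exact ⟨x, fun h => absurd h hx⟩
  choose y hy using hy
  let N : Finset V := {z ∈ S | ∃ x ∈ S, x ≠ z ∧ G.dist x z + G.dist w x = G.dist w z}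
  let A : Finset V := {z ∈ S | ¬ ∃ x ∈ S, x ≠ z ∧ G.dist x z + G.dist w x = G.dist w z}
  have hsplit : N.card + A.card = S.card := Finset.card_filter_add_card_filter_not _
  have hA : A.card ≤ Nat.sqrt (2 * 𝓛.card) + 1 := by
    have hd : ∀ a ∈ A, ∀ b ∈ A, a ≠ b → G.dist a b = G.dist w a + G.dist w b := by
      intro a ha b hb hab
      simp only [A, Finset.mem_filter] at ha hb
      have h1 := dist_eq_of_graphLine_eq ((hS a ha.1).1.trans (hS b hb.1).1.symm)
      have h2 : ¬ (G.dist a b + G.dist w a = G.dist w b) :=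
        fun h => hb.2 ⟨a, ha.1, hab, h⟩
      have h3 : ¬ (G.dist b a + G.dist w b = G.dist w a) :=
        fun h => ha.2 ⟨b, hb.1, hab.symm, h⟩
      have h4 := G.dist_comm (u := a) (v := b)
      omega
    have hpos : ∀ a ∈ A, G.dist w a ≠ 0 := by
      intro a ha
      simp only [A, Finset.mem_filter] at ha
      exact dist_ne_zero hG (fun h => hw (h ▸ hSL a ha.1))
    refine card_le_sqrt_of_no_col h𝓛 A ?_
    intro a ha b hb c hc hab hac hbc hcol
    simp only [Col] at hcol
    have h1 := hd a ha b hb hab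
    have h2 := hd a ha c hc hac
    have h3 := hd b hb c hc hbc
    have h4 := G.dist_comm (u := b) (v := c)
    have h5 := G.dist_comm (u := a) (v := c)
    have h6 := hpos a ha
    have h7 := hpos b hb
    have h8 := hpos c hc
    omega
  have hx : ∀ z, ∃ x, z ∈ N → x ∈ S ∧ x ≠ z ∧ G.dist x z + G.dist w x = G.dist w z := by
    intro z
    by_cases hz : z ∈ N
    · obtain ⟨x, h⟩ := (Finset.mem_filter.1 hz).2
      exact ⟨x, fun _ => h⟩
    · exact ⟨z, fun h => absurd h hz⟩
  choose x hx using hx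
  have hinner : ∀ z ∈ N, G.dist (x z) (y z) = G.dist (x z) z + 1 := by
    intro z hz
    obtain ⟨hxS, hne, hlt⟩ := hx z hz
    obtain ⟨hzy, hL⟩ := hy z (Finset.mem_filter.1 hz).1
    have h1 := dist_eq_of_not_mem_graphLine hG hzy (hL.symm ▸ hw)
    have h2 := dist_ne_of_mem_graphLine hzy (hL.symm ▸ hSL _ hxS)
    have h3 := hG.dist_triangle (u := x z) (v := z) (w := y z)
    have h4 := hG.dist_triangle (u := w) (v := x z) (w := y z)
    omega
  have hN : N.card ≤ 𝓛.card := by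
    refine Finset.card_le_card_of_injOn (fun z => graphLine G (x z) (y z)) ?_ ?_
    · intro z hz
      have h1 := hinner z hz
      refine h𝓛 _ _ (fun h => ?_)
      rw [h, SimpleGraph.dist_self] at h1
      omega
    · have aux : ∀ z ∈ N, ∀ t ∈ N, G.dist w z ≤ G.dist w t →
          graphLine G (x z) (y z) = graphLine G (x t) (y t) → z = t := by
        intro z hz t ht hr h
        by_contra hzt
        have hzS := (Finset.mem_filter.1 hz).1
        have htS := (Finset.mem_filter.1 ht).1
        obtain ⟨hxS, hne, hlt⟩ := hx z hz
        obtain ⟨hzy, hL⟩ := hy z hzS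
        refine not_mem_graphLine_of_lt hG hzy (hL.symm ▸ hw) (hL.symm ▸ hSL _ hxS)
          (hL.symm ▸ hSL _ htS) hlt hne (Ne.symm hzt) hr
          ((hS _ hxS).1.trans (hS _ htS).1.symm) ((hS _ hzS).1.trans (hS _ htS).1.symm) ?_
        rw [h, mem_graphLine, Col]
        have h1 := hinner t ht
        have h2 := (hy t htS).1
        omega
      intro z hz t ht h
      rcases le_total (G.dist w z) (G.dist w t) with hr | hr
      · exact aux z hz t ht hr h
      · exact (aux t ht z hz hr h.symm).symm
  omega

variable [Fintype V]

open Classical in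
theorem card_adjacent_pairs_le (hG : G.Connected)
    (h𝓛 : ∀ a b, a ≠ b → graphLine G a b ∈ 𝓛) {L : Set V} {w : V} (hw : w ∉ L) :
    ({p : V × V | G.dist p.1 p.2 = 1 ∧ graphLine G p.1 p.2 = L} : Finset (V × V)).card ≤
      (Nat.sqrt (2 * 𝓛.card) + 1) *
        ((𝓛.card + (Nat.sqrt (2 * 𝓛.card) + 1)) * 𝓛.card) := by
  set U : Finset V := {x | ∃ y, G.dist x y = 1 ∧ graphLine G x y = L}
  have hU : U.card ≤ (𝓛.card + (Nat.sqrt (2 * 𝓛.card) + 1)) * 𝓛.card := by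
    refine Finset.card_le_mul_card_image_of_maps_to (f := fun x => graphLine G w x) ?_ _ ?_
    · intro x hx
      simp only [U, Finset.mem_filter, Finset.mem_univ, true_and] at hx
      obtain ⟨y, -, rfl⟩ := hx
      exact h𝓛 _ _ (fun h => hw (h ▸ left_mem_graphLine _ _))
    · intro Λ _
      refine card_graphLine_fiber_le (Λ := Λ) hG h𝓛 hw _ ?_
      intro x hx
      simp only [U, Finset.mem_filter, Finset.mem_univ, true_and] at hx
      exact ⟨hx.2, hx.1⟩
  refine le_trans (Finset.card_le_mul_card_image_of_maps_to (f := Prod.fst) (t := U) ?_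
    (Nat.sqrt (2 * 𝓛.card) + 1) ?_) (Nat.mul_le_mul_left _ hU)
  · rintro ⟨a, b⟩ hp
    simp only [Finset.mem_filter, Finset.mem_univ, true_and] at hp
    simp only [U, Finset.mem_filter, Finset.mem_univ, true_and]
    exact ⟨b, hp⟩
  · intro a _
    set F : Finset V := {b | G.dist a b = 1 ∧ graphLine G a b = L}
    have hF : F.card ≤ Nat.sqrt (2 * 𝓛.card) + 1 := by
      -- Two neighbours of `a` on the same line through `a` must have `a` between them.
      have hd : ∀ b ∈ F, ∀ c ∈ F, b ≠ c → G.dist b c = 2 := by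
        intro b hb c hc hbc
        simp only [F, Finset.mem_filter, Finset.mem_univ, true_and] at hb hc
        have h1 : c ∈ graphLine G a b := hb.2.trans hc.2.symm ▸ right_mem_graphLine a c
        simp only [mem_graphLine, Col] at h1
        have h2 := dist_ne_zero hG hbc
        have h3 := G.dist_comm (u := b) (v := c)
        have h4 := G.dist_comm (u := a) (v := c)
        omega
      refine card_le_sqrt_of_no_col h𝓛 F ?_
      intro b hb c hc e he hbc hbe hce hcol
      simp only [Col] at hcol
      have h1 := hd b hb c hc hbc
      have h2 := hd b hb e he hbe
      have h3 := hd c hc e he hce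
      have h4 := hd e he c hc hce.symm
      have h5 := hd e he b hb hbe.symm
      omega
    refine (Finset.card_le_card_of_injOn Prod.snd ?_ ?_).trans hF
    · rintro ⟨a', b⟩ hp
      simp only [Finset.coe_filter, Finset.mem_filter, Finset.mem_univ, true_and,
        Set.mem_ofPred_eq] at hp
      simp only [F, Finset.coe_filter, Finset.mem_univ, true_and, Set.mem_ofPred_eq]
      obtain ⟨h, rfl⟩ := hp
      exact h
    · rintro ⟨a', b⟩ hp ⟨a'', b'⟩ hp' h
      simp only [Finset.coe_filter, Finset.mem_filter, Finset.mem_univ, true_and,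
        Set.mem_ofPred_eq] at hp hp' h
      rw [Prod.mk.injEq]
      exact ⟨hp.2.trans hp'.2.symm, h⟩

end AdjacentPairs

/-! ### Pairs at distance at least two generating a given line. -/

section DistantPairs

variable {𝓛 : Finset (Set V)}

/-- Walk along a shortest path from `u` through `a` to `b` inside a line generated by two
nonadjacent vertices `c`, `d`, where `c` is between `u` and `d`: the walk stays on the side of `c`
until it may enter the segment from `c` to `d`. -/
theorem dist_eq_or_of_path (hG : G.Connected) {u a b c d : V} (hcd : 2 ≤ G.dist c d)
    (hucd : G.dist u d = G.dist u c + G.dist c d)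
    (huab : G.dist u b = G.dist u a + G.dist a b)
    (hpath : ∀ e, G.dist u e + G.dist e a = G.dist u a ∨ G.dist a e + G.dist e b = G.dist a b →
      e ∈ graphLine G c d)
    (hb : G.dist u b = G.dist u d) (n : ℕ) : ∀ e, G.dist u e = n →
    (G.dist u e + G.dist e a = G.dist u a ∨ G.dist a e + G.dist e b = G.dist a b) →
    G.dist e d = G.dist e c + G.dist c d ∨
      (G.dist e c + G.dist e d = G.dist c d ∧ G.dist u e + G.dist e d = G.dist u d) := by
  induction n with
  | zero =>
    intro e he _
    left
    rw [← hG.dist_eq_zero_iff.1 he]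
    exact hucd
  | succ n ih =>
    intro e he hpe
    obtain ⟨f, hfe, huf, hpf⟩ : ∃ f, G.dist e f = 1 ∧ G.dist u f = n ∧
        (G.dist u f + G.dist f a = G.dist u a ∨ G.dist a f + G.dist f b = G.dist a b) := by
      by_cases hua : G.dist u e + G.dist e a = G.dist u a
      · obtain ⟨f, hf, hfu⟩ := exists_dist_succ hG (a := e) (b := u) (by
          rintro rfl
          simp at he)
        have h1 := G.dist_comm (u := e) (v := u)
        have h2 := G.dist_comm (u := f) (v := u)
        have h3 := hG.dist_triangle (u := f) (v := e) (w := a)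
        have h4 := hG.dist_triangle (u := u) (v := f) (w := a)
        have h5 := G.dist_comm (u := f) (v := e)
        exact ⟨f, hf, by omega, Or.inl (by omega)⟩
      · have hae := hpe.resolve_left hua
        have hne : e ≠ a := by
          rintro rfl
          simp at hua
        obtain ⟨f, hf, hfa⟩ := exists_dist_succ hG hne
        have h1 := G.dist_comm (u := e) (v := a)
        have h2 := G.dist_comm (u := f) (v := a)
        have h3 := hG.dist_triangle (u := f) (v := e) (w := b)
        have h4 := hG.dist_triangle (u := a) (v := f) (w := b)
        have h5 := G.dist_comm (u := f) (v := e)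
        have h6 := hG.dist_triangle (u := u) (v := a) (w := f)
        have h7 := hG.dist_triangle (u := u) (v := a) (w := e)
        have h8 := hG.dist_triangle (u := u) (v := e) (w := b)
        have h9 := hG.dist_triangle (u := u) (v := f) (w := e)
        exact ⟨f, hf, by omega, Or.inr (by omega)⟩
    have hS := ih f huf hpf
    have he' := hpath e hpe
    simp only [mem_graphLine, Col] at he'
    have c1 := G.dist_comm (u := e) (v := f)
    have c2 := G.dist_comm (u := c) (v := e)
    have c3 := G.dist_comm (u := d) (v := e)
    have t1 := hG.dist_triangle (u := e) (v := f) (w := c)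
    have t2 := hG.dist_triangle (u := f) (v := e) (w := c)
    have t3 := hG.dist_triangle (u := e) (v := f) (w := d)
    have t4 := hG.dist_triangle (u := f) (v := e) (w := d)
    have t5 := hG.dist_triangle (u := u) (v := e) (w := d)
    have t6 := hG.dist_triangle (u := u) (v := c) (w := e)
    have t7 := hG.dist_triangle (u := u) (v := c) (w := f)
    have t8 : G.dist u e ≤ G.dist u d := by
      have h7 := hG.dist_triangle (u := u) (v := a) (w := e)
      have h8 := hG.dist_triangle (u := u) (v := e) (w := b)
      omega
    have c4 := G.dist_comm (u := c) (v := f)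
    -- One step cannot jump from the side of `c` past `d`, because `c` and `d` are not adjacent;
    -- leaving the segment at `d` would exceed the distance from `u` to `d`.
    omega

theorem path_mem_graphLine {u a b e : V} (huab : G.dist u b = G.dist u a + G.dist a b)
    (hG : G.Connected)
    (h : G.dist u e + G.dist e a = G.dist u a ∨ G.dist a e + G.dist e b = G.dist a b) :
    e ∈ graphLine G a b := by
  simp only [mem_graphLine, Col]
  have h1 := hG.dist_triangle (u := u) (v := e) (w := b)
  have h2 := hG.dist_triangle (u := e) (v := a) (w := b)
  omega

/-- Far ends of two pairs that generate the same line, at the same distance from `u`. -/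
theorem eq_or_dist_eq (hG : G.Connected) {u a b c d : V} (hcd : 2 ≤ G.dist c d)
    (hucd : G.dist u d = G.dist u c + G.dist c d)
    (huab : G.dist u b = G.dist u a + G.dist a b)
    (hL : graphLine G a b = graphLine G c d) (hb : G.dist u b = G.dist u d) :
    b = d ∨ G.dist b d = G.dist b c + G.dist c d := by
  have h := dist_eq_or_of_path hG hcd hucd huab
    (fun e he => hL ▸ path_mem_graphLine huab hG he) hb _ b rfl (Or.inr (by simp))
  rcases h with h | h
  · exact Or.inr h
  · exact Or.inl (hG.dist_eq_zero_iff.1 (by omega))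

/-- Near ends of two pairs with the same far end that generate the same line. -/
theorem eq_of_dist_eq (hG : G.Connected) {u a c d : V} (hcd : 2 ≤ G.dist c d)
    (hucd : G.dist u d = G.dist u c + G.dist c d)
    (huad : G.dist u d = G.dist u a + G.dist a d)
    (hL : graphLine G a d = graphLine G c d) (ha : G.dist a d = G.dist c d) : a = c := by
  have h := dist_eq_or_of_path hG hcd hucd huad
    (fun e he => hL ▸ path_mem_graphLine huad hG he) rfl _ a rfl (Or.inl (by simp))
  exact hG.dist_eq_zero_iff.1 (by omega)

variable [Fintype V]

open Classical in
-- Classify a pair by its length and the distance of its far end from `u`. Within a class the far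
-- end determines the pair, and no three far ends are collinear: if one were between two others, its
-- near end would give a shortcut.
theorem card_radial_pairs_le (hG : G.Connected) (h𝓛 : ∀ a b, a ≠ b → graphLine G a b ∈ 𝓛)
    (L : Set V) (u : V) {D : ℕ} (hD : ∀ v, G.dist u v ≤ D) :
    ({p : V × V | 2 ≤ G.dist p.1 p.2 ∧ graphLine G p.1 p.2 = L ∧
      G.dist u p.2 = G.dist u p.1 + G.dist p.1 p.2 ∧ p.1 ≠ u} : Finset (V × V)).card ≤
      (Nat.sqrt (2 * 𝓛.card) + 1) * D.choose 2 := by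
  set T : Finset (V × V) := {p : V × V | 2 ≤ G.dist p.1 p.2 ∧ graphLine G p.1 p.2 = L ∧
      G.dist u p.2 = G.dist u p.1 + G.dist p.1 p.2 ∧ p.1 ≠ u}
  have hT : ∀ p, p ∈ T ↔ 2 ≤ G.dist p.1 p.2 ∧ graphLine G p.1 p.2 = L ∧
      G.dist u p.2 = G.dist u p.1 + G.dist p.1 p.2 ∧ p.1 ≠ u := by
    intro p
    simp [T]
  have hcard : ((Finset.Icc 1 D).powersetCard 2).card = D.choose 2 := by simp
  rw [← hcard]
  refine Finset.card_le_mul_card_image_of_maps_to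
    -- As `p.1 ≠ u`, the length is strictly the smaller entry, so an unordered pair loses nothing
    -- and the count is a binomial coefficient.
    (f := fun p : V × V => ({G.dist p.1 p.2, G.dist u p.2} : Finset ℕ)) ?_ _ ?_
  · intro p hp
    obtain ⟨h1, -, h2, h3⟩ := (hT p).1 hp
    have h4 := dist_ne_zero hG h3.symm
    have h5 := hD p.2
    rw [Finset.mem_powersetCard]
    refine ⟨?_, Finset.card_pair (by omega)⟩
    intro i hi
    simp only [Finset.mem_insert, Finset.mem_singleton] at hi
    rw [Finset.mem_Icc]
    omega
  · intro s _
    set F : Finset (V × V) := {p ∈ T | ({G.dist p.1 p.2, G.dist u p.2} : Finset ℕ) = s}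
    have hF : ∀ p ∈ F, ∀ q ∈ F,
        G.dist p.1 p.2 = G.dist q.1 q.2 ∧ G.dist u p.2 = G.dist u q.2 := by
      intro p hp q hq
      obtain ⟨hpT, hps⟩ := Finset.mem_filter.1 hp
      obtain ⟨hqT, hqs⟩ := Finset.mem_filter.1 hq
      obtain ⟨h1, -, h2, h3⟩ := (hT p).1 hpT
      obtain ⟨k1, -, k2, k3⟩ := (hT q).1 hqT
      have h4 := dist_ne_zero hG h3.symm
      have k4 := dist_ne_zero hG k3.symm
      have e1 : G.dist p.1 p.2 ∈ ({G.dist q.1 q.2, G.dist u q.2} : Finset ℕ) := by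
        rw [hqs, ← hps]; simp
      have e2 : G.dist u p.2 ∈ ({G.dist q.1 q.2, G.dist u q.2} : Finset ℕ) := by
        rw [hqs, ← hps]; simp
      have e3 : G.dist u q.2 ∈ ({G.dist p.1 p.2, G.dist u p.2} : Finset ℕ) := by
        rw [hps, ← hqs]; simp
      simp only [Finset.mem_insert, Finset.mem_singleton] at e1 e2 e3
      omega
    have hinj : Set.InjOn Prod.snd (F : Set (V × V)) := by
      rintro ⟨a, b⟩ hp ⟨c, d⟩ hq h
      change b = d at h
      subst h
      have h1 := (hT _).1 (Finset.mem_filter.1 hp).1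
      have h2 := (hT _).1 (Finset.mem_filter.1 hq).1
      exact Prod.ext (eq_of_dist_eq hG h2.1 h2.2.2.1 h1.2.2.1 (h1.2.1.trans h2.2.1.symm)
        (hF _ hp _ hq).1) rfl
    rw [← Finset.card_image_of_injOn hinj]
    have hd : ∀ p ∈ F, ∀ q ∈ F, p.2 ≠ q.2 →
        G.dist p.2 q.2 = G.dist p.2 q.1 + G.dist q.1 q.2 := by
      intro p hp q hq hne
      have h1 := (hT _).1 (Finset.mem_filter.1 hp).1
      have h2 := (hT _).1 (Finset.mem_filter.1 hq).1
      exact (eq_or_dist_eq hG h2.1 h2.2.2.1 h1.2.2.1 (h1.2.1.trans h2.2.1.symm)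
        (hF _ hp _ hq).2).resolve_left hne
    have hbtw : ∀ p ∈ F, ∀ q ∈ F, ∀ r ∈ F, p.2 ≠ q.2 → r.2 ≠ q.2 →
        G.dist p.2 r.2 ≠ G.dist p.2 q.2 + G.dist q.2 r.2 := by
      intro p hp q hq r hr hpq hrq h
      have h1 := hd p hp q hq hpq
      have h2 := hd r hr q hq hrq
      have h3 := hG.dist_triangle (u := p.2) (v := q.1) (w := r.2)
      have h4 := G.dist_comm (u := q.1) (v := r.2)
      have h5 := G.dist_comm (u := q.2) (v := r.2)
      have h6 := ((hT _).1 (Finset.mem_filter.1 hq).1).1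
      omega
    refine card_le_sqrt_of_no_col h𝓛 _ ?_
    intro a ha b hb c hc hab hac hbc hcol
    obtain ⟨p, hp, rfl⟩ := Finset.mem_image.1 ha
    obtain ⟨q, hq, rfl⟩ := Finset.mem_image.1 hb
    obtain ⟨r, hr, rfl⟩ := Finset.mem_image.1 hc
    rcases hcol with h | h | h
    · exact hbtw p hp r hr q hq hac hbc h
    · exact hbtw p hp q hq r hr hab hbc.symm h
    · exact hbtw r hr p hp q hq hac.symm hab.symm h

open Classical in
-- Take `u`, `v` farthest apart among the ends of the pairs. A pair avoiding `u` is radial from `u`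
-- in one of its orientations, or has `u` between its ends; then `v` on the line forces the maximal
-- length.
theorem card_distant_pairs_le (hG : G.Connected) (h𝓛 : ∀ a b, a ≠ b → graphLine G a b ∈ 𝓛)
    (L : Set V) {D : ℕ} (hD : ∀ u v, G.dist u v ≤ D) :
    ({p : V × V | 2 ≤ G.dist p.1 p.2 ∧ graphLine G p.1 p.2 = L} : Finset (V × V)).card ≤
      3 * Fintype.card V + 2 * ((Nat.sqrt (2 * 𝓛.card) + 1) * D.choose 2) := by
  set T : Finset (V × V) := {p : V × V | 2 ≤ G.dist p.1 p.2 ∧ graphLine G p.1 p.2 = L}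
  have hT : ∀ p, p ∈ T ↔ 2 ≤ G.dist p.1 p.2 ∧ graphLine G p.1 p.2 = L := by
    intro p
    simp [T]
  have hTs : ∀ p ∈ T, p.swap ∈ T := by
    intro p hp
    rw [hT] at hp ⊢
    rw [Prod.fst_swap, Prod.snd_swap, G.dist_comm, graphLine_comm]
    exact hp
  rcases T.eq_empty_or_nonempty with h0 | hne
  · simp [h0]
  set U : Finset V := T.image Prod.fst
  have hUL : ∀ x ∈ U, x ∈ L := by
    intro x hx
    obtain ⟨p, hp, rfl⟩ := Finset.mem_image.1 hx
    exact ((hT p).1 hp).2 ▸ left_mem_graphLine _ _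
  have hU1 : ∀ p ∈ T, p.1 ∈ U := fun p hp => Finset.mem_image_of_mem _ hp
  have hU2 : ∀ p ∈ T, p.2 ∈ U := fun p hp => hU1 _ (hTs p hp)
  obtain ⟨⟨u, v⟩, huv, hmax⟩ := Finset.exists_max_image (U ×ˢ U) (fun p => G.dist p.1 p.2)
    ((hne.image _).product (hne.image _))
  rw [Finset.mem_product] at huv
  have hmax' : ∀ x ∈ U, ∀ y ∈ U, G.dist x y ≤ G.dist u v :=
    fun x hx y hy => hmax (x, y) (Finset.mem_product.2 ⟨hx, hy⟩)
  set M := G.dist u v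
  set R : Finset (V × V) := {p : V × V | 2 ≤ G.dist p.1 p.2 ∧ graphLine G p.1 p.2 = L ∧
      G.dist u p.2 = G.dist u p.1 + G.dist p.1 p.2 ∧ p.1 ≠ u}
  have hR : R.card ≤ (Nat.sqrt (2 * 𝓛.card) + 1) * D.choose 2 :=
    card_radial_pairs_le hG h𝓛 L u (hD u)
  set E : Finset (V × V) := {p ∈ T | G.dist p.1 p.2 = M}
  -- Two far ends for the same `c` would be collinear with it at distance 0 or 2M, and 2M exceeds
  -- the maximum.
  have hE : E.card ≤ Fintype.card V := by
    refine Finset.card_le_card_of_injOn Prod.fst (fun _ _ => Finset.mem_univ _) ?_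
    rintro ⟨c, d⟩ hp ⟨c', d'⟩ hq h
    change c = c' at h
    subst h
    obtain ⟨hpT, hpM⟩ := Finset.mem_filter.1 hp
    obtain ⟨hqT, hqM⟩ := Finset.mem_filter.1 hq
    have h1 := (hT _).1 hpT
    have h2 : d' ∈ graphLine G c d := by
      rw [h1.2]
      exact hUL _ (hU2 _ hqT)
    have h3 := hmax' _ (hU2 _ hpT) _ (hU2 _ hqT)
    simp only [mem_graphLine, Col] at h2
    simp only at hpM hqM h1 h3
    have h4 := G.dist_comm (u := d) (v := d')
    have h5 := G.dist_comm (u := c) (v := d')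
    have h6 : d = d' := hG.dist_eq_zero_iff.1 (by omega)
    rw [h6]
  have hcover : T ⊆ (E ∪ (Finset.univ.image (fun x => (u, x)) ∪
      Finset.univ.image (fun x => (x, u)))) ∪ (R ∪ R.image Prod.swap) := by
    rintro ⟨c, d⟩ hp
    by_cases hcu : c = u
    · simp [hcu]
    by_cases hdu : d = u
    · simp [hdu]
    have h1 := (hT _).1 hp
    have hu : u ∈ graphLine G c d := by
      rw [h1.2]
      exact hUL _ huv.1
    have hv : v ∈ graphLine G c d := by
      rw [h1.2]
      exact hUL _ huv.2
    simp only [mem_graphLine, Col] at hu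
    have c1 := G.dist_comm (u := c) (v := u)
    have c2 := G.dist_comm (u := d) (v := u)
    have c3 := G.dist_comm (u := c) (v := d)
    rcases hu with hu | hu | hu
    · have hM : G.dist c d = M := by
        simp only [mem_graphLine, Col] at hv
        have m1 := hmax' _ (hU1 _ hp) _ (hU2 _ hp)
        have m2 := hmax' _ (hU1 _ hp) _ huv.2
        have m3 := hmax' _ (hU2 _ hp) _ huv.2
        have t1 := hG.dist_triangle (u := u) (v := c) (w := v)
        have t2 := hG.dist_triangle (u := u) (v := d) (w := v)
        have c4 := G.dist_comm (u := v) (v := d)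
        have c5 := G.dist_comm (u := v) (v := c)
        have p1 := dist_ne_zero hG hcu
        have p2 := dist_ne_zero hG hdu
        simp only at m1 m2 m3
        omega
      have : (c, d) ∈ E := Finset.mem_filter.2 ⟨hp, hM⟩
      simp [this]
    · have : (d, c) ∈ R := by
        simp only [R, Finset.mem_filter, Finset.mem_univ, true_and]
        refine ⟨by have := h1.1; simp only at this; omega, ?_, by omega, hdu⟩
        rw [graphLine_comm]
        exact h1.2
      have h2 : (c, d) ∈ R.image Prod.swap := Finset.mem_image.2 ⟨_, this, rfl⟩
      exact Finset.mem_union_right _ (Finset.mem_union_right _ h2)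
    · have : (c, d) ∈ R := by
        simp only [R, Finset.mem_filter, Finset.mem_univ, true_and]
        exact ⟨h1.1, h1.2, by omega, hcu⟩
      exact Finset.mem_union_right _ (Finset.mem_union_left _ this)
  have k1 := Finset.card_le_card hcover
  have k2 := Finset.card_union_le (E ∪ (Finset.univ.image (fun x => (u, x)) ∪
      Finset.univ.image (fun x => (x, u)))) (R ∪ R.image Prod.swap)
  have k3 := Finset.card_union_le E (Finset.univ.image (fun x => (u, x)) ∪
      Finset.univ.image (fun x => (x, u)))
  have k4 := Finset.card_union_le (Finset.univ.image (fun x : V => (u, x)))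
      (Finset.univ.image (fun x => (x, u)))
  have k5 := Finset.card_union_le R (R.image Prod.swap)
  have k6 : (R.image Prod.swap).card ≤ R.card := Finset.card_image_le
  have k7 : (Finset.univ.image (fun x : V => (u, x))).card ≤ Fintype.card V :=
    Finset.card_image_le
  have k8 : (Finset.univ.image (fun x : V => (x, u))).card ≤ Fintype.card V :=
    Finset.card_image_le
  omega

end DistantPairs

/-! ### The double count, the numerical estimate and the conclusion. -/

variable {𝓛 : Finset (Set V)}

theorem card_mul_card_le [Fintype V] (hG : G.Connected)
    (h𝓛 : ∀ a b, a ≠ b → graphLine G a b ∈ 𝓛)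
    (hU : ∀ a b, a ≠ b → ∃ w, w ∉ graphLine G a b) :
    Fintype.card V * Fintype.card V ≤ Fintype.card V +
      (3 * Fintype.card V + 4 * (Nat.sqrt (2 * 𝓛.card) + 1) * 𝓛.card ^ 2 +
        (Nat.sqrt (2 * 𝓛.card) + 1) * (𝓛.card + (Nat.sqrt (2 * 𝓛.card) + 1)) * 𝓛.card) *
        𝓛.card := by
  classical
  set P := Nat.sqrt (2 * 𝓛.card) + 1
  set m := 𝓛.card
  set n := Fintype.card V
  have key : (Finset.univ : Finset V).offDiag.card ≤
      (3 * n + 4 * P * m ^ 2 + P * (m + P) * m) * m := by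
    refine Finset.card_le_mul_card_image_of_maps_to (f := fun p : V × V => graphLine G p.1 p.2)
      (fun p hp => h𝓛 _ _ (Finset.mem_offDiag.1 hp).2.2) _ ?_
    intro L _
    rcases Finset.eq_empty_or_nonempty
      {p ∈ (Finset.univ : Finset V).offDiag | graphLine G p.1 p.2 = L} with h0 | ⟨⟨a, b⟩, hab⟩
    · simp [h0]
    · simp only [Finset.mem_filter, Finset.mem_offDiag] at hab
      obtain ⟨⟨-, -, hne⟩, rfl⟩ := hab
      obtain ⟨w, hw⟩ := hU a b hne
      have h1 := card_adjacent_pairs_le hG h𝓛 hw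
      have h2 := card_distant_pairs_le hG h𝓛 (graphLine G a b)
        (dist_le_two_mul_card hG h𝓛 hU)
      refine le_trans (Finset.card_le_card ?_) (le_trans (Finset.card_union_le _ _)
        (le_trans (Nat.add_le_add h2 h1) ?_))
      · rintro ⟨c, d⟩ hp
        simp only [Finset.mem_filter, Finset.mem_offDiag] at hp
        have h3 := dist_ne_zero hG hp.1.2.2
        simp only [Finset.mem_union, Finset.mem_filter, Finset.mem_univ, true_and, hp.2, and_true]
        omega
      · have h3 : (2 * m).choose 2 ≤ 2 * m ^ 2 := by
          rw [Nat.choose_two_right]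
          have h4 : 2 * m * (2 * m - 1) ≤ 2 * m * (2 * m) := Nat.mul_le_mul_left _ (by omega)
          have h5 : 2 * m * (2 * m) = 2 * (2 * m ^ 2) := by ring
          omega
        have h4 := Nat.mul_le_mul_left P h3
        change 3 * n + 2 * (P * (2 * m).choose 2) + P * ((m + P) * m) ≤ _
        have h5 : P * (2 * m ^ 2) = 2 * (P * m ^ 2) := by ring
        have h6 : 4 * P * m ^ 2 = 4 * (P * m ^ 2) := by ring
        have h7 : P * ((m + P) * m) = P * (m + P) * m := by ring
        omega
  rw [Finset.offDiag_card, Finset.card_univ] at key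
  change n * n - n ≤ _ at key
  omega

/-- With s = n^(2/7), assuming m < s²/2 gives √(2m) ≤ s, and the right side is at most (5/8)s⁷ +
O(s⁶), against n² = s⁷. The bound 20 on s leaves ample room for the lower-order terms. -/
theorem half_mul_rpow_le {n m : ℕ} (hn : 20 ^ 4 ≤ n)
    (h : n * n ≤ n + (3 * n + 4 * (Nat.sqrt (2 * m) + 1) * m ^ 2 +
      (Nat.sqrt (2 * m) + 1) * (m + (Nat.sqrt (2 * m) + 1)) * m) * m) :
    (1 / 2 : ℝ) * (n : ℝ) ^ (4 / 7 : ℝ) ≤ m := by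
  by_contra hlt
  push Not at hlt
  have hn' : (20 : ℝ) ^ 4 ≤ n := by exact_mod_cast hn
  have hn0 : (0 : ℝ) ≤ n := Nat.cast_nonneg n
  obtain ⟨s, hs⟩ : ∃ s : ℝ, s = (n : ℝ) ^ (2 / 7 : ℝ) := ⟨_, rfl⟩
  have hs0 : 0 ≤ s := hs ▸ Real.rpow_nonneg hn0 _
  have hs7 : s ^ 7 = (n : ℝ) ^ 2 := by
    rw [hs, ← Real.rpow_natCast, ← Real.rpow_mul hn0, ← Real.rpow_natCast]
    norm_num
  have hs2 : (n : ℝ) ^ (4 / 7 : ℝ) = s ^ 2 := by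
    rw [hs, ← Real.rpow_natCast, ← Real.rpow_mul hn0]
    norm_num
  rw [hs2] at hlt
  have hs20 : 20 ≤ s := by
    refine le_of_pow_le_pow_left₀ (n := 7) (by norm_num) hs0 ?_
    rw [hs7]
    nlinarith
  have hns : (n : ℝ) ≤ s ^ 4 := by
    refine le_of_pow_le_pow_left₀ (n := 2) (by norm_num) (by positivity) ?_
    rw [← hs7, ← pow_mul]
    exact pow_le_pow_right₀ (by linarith) (by norm_num)
  have hm : (m : ℝ) ≤ s ^ 2 / 2 := by linarith
  have hP : ((Nat.sqrt (2 * m) + 1 : ℕ) : ℝ) ≤ s + 1 := by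
    have h1 : Nat.sqrt (2 * m) * Nat.sqrt (2 * m) ≤ 2 * m := Nat.sqrt_le _
    have h2 : (Nat.sqrt (2 * m) : ℝ) * Nat.sqrt (2 * m) ≤ 2 * m := by exact_mod_cast h1
    have h3 : (Nat.sqrt (2 * m) : ℝ) ≤ s := abs_le_of_sq_le_sq' (by nlinarith) hs0 |>.2
    push_cast
    linarith
  generalize Nat.sqrt (2 * m) + 1 = P at h hP
  have h' : (n : ℝ) ^ 2 ≤ n + (3 * n + 4 * P * m ^ 2 + P * (m + P) * m) * m := by
    rw [sq]
    exact_mod_cast h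
  have hbound : (n : ℝ) + (3 * n + 4 * P * m ^ 2 + P * (m + P) * m) * m ≤
      s ^ 4 + (3 * s ^ 4 + 4 * (s + 1) * (s ^ 2 / 2) ^ 2 +
        (s + 1) * (s ^ 2 / 2 + (s + 1)) * (s ^ 2 / 2)) * (s ^ 2 / 2) := by
    gcongr
  rw [← hs7] at h'
  have h4 : 0 < s ^ 4 := by positivity
  have h5 : s ^ 4 * s ^ 3 ≤ s ^ 4 * (1 + (3 * s ^ 2 / 2 + (s + 1) * s ^ 2 / 2 +
      (s + 1) * (s ^ 2 / 2 + (s + 1)) / 4)) := by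
    have := h'.trans hbound
    ring_nf at this ⊢
    linarith
  have h6 := le_of_mul_le_mul_left h5 h4
  nlinarith [mul_nonneg (sq_nonneg s) (sub_nonneg.2 hs20), mul_nonneg hs0 (sub_nonneg.2 hs20)]

/-- `Col` admits coincidences, which absorbs the two generators. The hypothesis `a ≠ b` matters:
`graphLine G a a` is everything. -/
theorem line_eq_graphLine {V : Type*} [MetricSpace V] {G : SimpleGraph V}
    (hd : ∀ u v : V, dist u v = (G.dist u v : ℝ)) {a b : V} (hab : a ≠ b) :
    MetricLines.line a b = graphLine G a b := by
  ext c
  simp only [MetricLines.line, MetricLines.Between, Set.mem_union, Set.mem_insert_iff,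
    Set.mem_singleton_iff, Set.mem_ofPred_eq, mem_graphLine, Col, hd]
  norm_cast
  by_cases hca : c = a
  · subst hca
    simp
  by_cases hcb : c = b
  · subst hcb
    simp
  have h1 := G.dist_comm (u := a) (v := b)
  have h2 := G.dist_comm (u := c) (v := b)
  have h3 := G.dist_comm (u := a) (v := c)
  simp only [hca, hcb, Ne.symm hca, Ne.symm hcb, hab, hab.symm, not_false_eq_true,
    true_and, false_or]
  omega

end GraphLines

theorem theorem7p6 :
    ∃ ε : ℕ → ℝ, Tendsto ε atTop (𝓝 0) ∧
      ∀ (V : Type*) [Fintype V] [MetricSpace V], MetricLines.IsGraphMetric V →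
        MetricLines.HasUniversalLine V ∨
          (1 / 2 - ε (Fintype.card V)) * (Fintype.card V : ℝ) ^ (4 / 7 : ℝ) ≤
            ((MetricLines.lines V).ncard : ℝ) := by
  -- The value 1 makes the claimed bound nonpositive for small n.
  refine ⟨fun n => if n < 20 ^ 4 then 1 else 0, ?_, ?_⟩
  · refine tendsto_const_nhds.congr' ?_
    filter_upwards [eventually_ge_atTop (20 ^ 4)] with n hn
    rw [if_neg (by omega)]
  intro V _ _ ⟨G, hG, hd⟩
  rw [or_iff_not_imp_left]
  intro hU
  beta_reduce
  split_ifs with hn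
  · have h : (0 : ℝ) ≤ (Fintype.card V : ℝ) ^ (4 / 7 : ℝ) := by positivity
    have h' : (0 : ℝ) ≤ ((MetricLines.lines V).ncard : ℝ) := by positivity
    linarith
  rw [sub_zero, Set.ncard_eq_toFinset_card _ (Set.toFinite _)]
  have h𝓛 : ∀ a b, a ≠ b →
      GraphLines.graphLine G a b ∈ (Set.toFinite (MetricLines.lines V)).toFinset := by
    intro a b hab
    rw [Set.Finite.mem_toFinset]
    exact ⟨a, b, hab, (GraphLines.line_eq_graphLine hd hab).symm⟩
  refine GraphLines.half_mul_rpow_le (not_lt.1 hn) (GraphLines.card_mul_card_le hG h𝓛 ?_)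
  intro a b hab
  by_contra! hcon
  exact hU ⟨_, ⟨a, b, hab, rfl⟩, fun x => GraphLines.line_eq_graphLine hd hab ▸ hcon x⟩
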